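/- Let $\widehat{\mathfrak g}$ be of type $A_n^{(1)}$ ($n\ge1$), $B_n^{(1)}$ ($n\ge3$), $C_n^{(1)}$ ($n\ge2$) or $D_n^{(1)}$ ($n\ge4$), with Cartan matrix $(A_{ij})_{0\le i,j\le n}$ and $d_i$ such that $d_iA_{ij}=d_jA_{ji}$ (all $d_i=1$, except $d_n=\frac12$ for $B_n^{(1)}$ and $d_1=\dots=d_{n-1}=\frac12$ for $C_n^{(1)}$). Put $q_i=q^{d_i}$, $[m]_i=\frac{q_i^m-q_i^{-m}}{q_i-q_i^{-1}}$. Let $U_q(\widehat{\mathfrak g})$ be the quantum affine algebra over $\mathbb C(q^{1/2})$ with Chevalley generators $e_i,f_i,q^h$, $t_i=q_i^{h_i}$, let $U_q'(\widehat{\mathfrak g})$ be the subalgebra generated by $e_i,f_i,t_i^{\pm1}$, with coproduct $\Delta(e_i)=e_i\otimes1+t_i\otimes e_i$, $\Delta(f_i)=f_i\otimes t_i^{-1}+1\otimes f_i$, $\Delta(t_i)=t_i\otimes t_i$ and antipode $S(e_i)=-t_i^{-1}e_i$, $S(f_i)=-f_it_i$, $S(t_i)=t_i^{-1}$. Consider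 the following graph with coloured arrows. Type $A_n^{(1)}$: vertices $1,\dots,n+1$; arrows $k\xrightarrow{k}k+1$ ($1\le k\le n$) and $n+1\xrightarrow{0}1$; we put $\overline1:=n+1$. In the other types the vertices are $1,\dots,n,\overline n,\dots,\overline1$, and also $0$ in type $B_n^{(1)}$; there are arrows $k\xrightarrow{k}k+1$, $\overline{k+1}\xrightarrow{k}\overline k$ ($1\le k\le n-1$); in addition $n\xrightarrow{n}0\xrightarrow{n}\overline n$, $\overline2\xrightarrow{0}1$, $\overline1\xrightarrow{0}2$ for $B_n^{(1)}$; $n\xrightarrow{n}\overline n$, $\overline1\xrightarrow{0}1$ for $C_n^{(1)}$; $n-1\xrightarrow{n}\overline n$, $n\xrightarrow{n}\overline{n-1}$, $\overline2\xrightarrow{0}1$, $\overline1\xrightarrow{0}2$ for $D_n^{(1)}$. For a vertex $i$ and a colour $k$ let $r'_{i,k}$ (resp. $r_{i,k}$) be the number of $k$-arrows going out of (resp. coming into) $i$, counted along the whole $k$-string that starts (resp. ends) at $i$, and let $(wt(i),h_k)=r'_{i,k}-r_{i,k}$. Let $V$ be the $U_q'(\widehat{\mathfrak g})$-module with basis $(v_i)$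 indexed by the vertices, on which $t_kv_i=q_k^{(wt(i),h_k)}v_i$ and, for every arrow $i\xrightarrow{k}j$, $e_kv_j=v_i$, $f_kv_i=v_j$, except that in type $B_n^{(1)}$ $e_nv_0=[2]_nv_n$ and $f_nv_0=[2]_nv_{\overline n}$; $e_k$ (resp. $f_k$) kills the basis vectors that are not the target (resp. source) of a $k$-arrow. Let $V^*$ be the dual module, $(xv^*)(u)=v^*(S(x)u)$, with dual basis $(v_i^*)$. For $W=V,V^*$ let $W_z=W\otimes\mathbb C(q^{1/2})[z,z^{-1}]$, where $e_i(v\otimes z^m)=e_iv\otimes z^{m+\delta_{i0}}$, $f_i(v\otimes z^m)=f_iv\otimes z^{m-\delta_{i0}}$, $t_i(v\otimes z^m)=t_iv\otimes z^m$. Let $M,N$ be $U_q'(\widehat{\mathfrak g})$-modules (for instance $M=V(\lambda)$, $N=V(\mu)$ highest weight modules of $U_q(\widehat{\mathfrak g})$). A type II vertex operator with respect to $W_z$ is a $U_q'(\widehat{\mathfrak g})$-intertwining operator $M\to W_z\widehat\otimes N$, where $W_z\widehat\otimes N$ consists of the formal sums $\sum_{j}\sum_{m\in\mathbb Z}(w_j\otimes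 z^m)\otimes n_{j,m}$ with $n_{j,m}\in N$, $(w_j)$ the given basis of $W$, and $U'_q(\widehat{\mathfrak g})$ acts through $\Delta$. Its components are the operators from $M$ to $N[[z,z^{-1}]]$ given by $\Phi(z)u=\sum_jv_j\otimes\Phi_j(z)u$, resp. $\Phi^*(z)u=\sum_jv_j^*\otimes\Phi_j^*(z)u$. Write $[a,b]_c=ab-c\,ba$. Then: (a) A type II vertex operator $\Phi(z)$ with respect to $V_z$ is determined by its component $\Phi_1(z)$. More precisely, for every arrow $i\xrightarrow{k}j$, $$\Phi_j(z)=z^{-\delta_{k,0}}\,[r'_{i,k}]_k^{-1}\,[\Phi_i(z),e_k]_{q_k^{(wt(i),h_k)}}.$$ (b) A type II vertex operator $\Phi^*(z)$ with respect to $V_z^*$ is determined by its component $\Phi^*_{\overline1}(z)$. For every arrow $i\xrightarrow{k}j$, $$\Phi_i^*(z)=z^{-\delta_{k,0}}\,q_k^2\,[r'_{i,k}]_k^{-1}\,[e_k,\Phi_j^*(z)]_{q_k^{(wt(j),h_k)}}.$$ -/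

import Mathlib

/-! Untwisted quantum affine algebras of classical type, their vector representations, and
type II vertex operators. -/

namespace QAff

/-- The four classical series. -/
inductive Series
  | A
  | B
  | C
  | D

/-- Smallest rank for which the affine diagram of the series is defined (Kac's convention). -/
def Series.minRank : Series → ℕ
  | .A => 1
  | .B => 3
  | .C => 2
  | .D => 4

/-- An affine type `A_n^{(1)}`, `B_n^{(1)}`, `C_n^{(1)}` or `D_n^{(1)}`. -/
structure AffineType where
  series : Series
  rank : ℕ
  minRank_le : series.minRank ≤ rank

/-- The ground field `ℂ(q^{1/2})`; the variable of `RatFunc` is `q^{1/2}`. -/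
abbrev K : Type := RatFunc ℂ

namespace AffineType

variable (X : AffineType)

/-- The index set `I = {0, 1, …, n}`. -/
abbrev Node : Type := Fin (X.rank + 1)

/-- The affine generalized Cartan matrix of the series in rank `n`. -/
def cartanNat : Series → ℕ → ℕ → ℕ → ℤ
  | .A, n, i, j =>
    if i = j then 2
    else if n = 1 then -2
    else if i + 1 = j ∨ j + 1 = i ∨ (i = 0 ∧ j = n) ∨ (i = n ∧ j = 0) then -1
    else 0
  | .B, n, i, j =>
    if i = j then 2
    else if i = n ∧ j + 1 = n then -2
    else if (1 ≤ i ∧ i + 1 = j) ∨ (1 ≤ j ∧ j + 1 = i) ∨ (i = 0 ∧ j = 2) ∨ (i = 2 ∧ j = 0) then -1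
    else 0
  | .C, n, i, j =>
    if i = j then 2
    else if (i = 1 ∧ j = 0) ∨ (i + 1 = n ∧ j = n) then -2
    else if i + 1 = j ∨ j + 1 = i then -1
    else 0
  | .D, n, i, j =>
    if i = j then 2
    else if (1 ≤ i ∧ i + 1 = j ∧ j < n) ∨ (1 ≤ j ∧ j + 1 = i ∧ i < n) ∨
        (i = 0 ∧ j = 2) ∨ (i = 2 ∧ j = 0) ∨ (i + 2 = n ∧ j = n) ∨ (i = n ∧ j + 2 = n) then -1
    else 0

/-- The generalized Cartan matrix `(A_{ij})`. -/
def cartan (i j : X.Node) : ℤ := cartanNat X.series X.rank i j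

/-- `2 d_i`, where `(α_i|α_j) = d_i A_{ij}`. -/
def twoD (i : X.Node) : ℕ :=
  match X.series with
  | .A => 2
  | .B => if (i : ℕ) = X.rank then 1 else 2
  | .C => if (i : ℕ) = 0 ∨ (i : ℕ) = X.rank then 2 else 1
  | .D => 2

/-- `q_i = q^{d_i}`. -/
noncomputable def q (i : X.Node) : K := RatFunc.X ^ X.twoD i

/-- `[m]_i = (q_i^m - q_i^{-m}) / (q_i - q_i^{-1})`. -/
noncomputable def qInt (i : X.Node) (m : ℕ) : K :=
  (X.q i ^ m - (X.q i ^ m)⁻¹) / (X.q i - (X.q i)⁻¹)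

/-- `[m]_i!`. -/
noncomputable def qFactorial (i : X.Node) (m : ℕ) : K :=
  ∏ k ∈ Finset.Icc 1 m, X.qInt i k

/-! ### The quantum affine algebra -/

/-- The lattice of exponents `h` of the elements `q^h`: the pair `(c, m)` stands for
`∑ i, c i • (d_i h_i) + m d`. It contains all the `h_i` and `d`, and `d_i h_i`, so that
`t_i = q_i^{h_i} = q^{d_i h_i}` belongs to the algebra also when `d_i = 1/2`. -/
abbrev Coweight : Type := (X.Node → ℤ) × ℤ

/-- `2 α_j(h)`, where `α_j(h_i) = A_{ij}` and `α_j(d) = δ_{j0}`. -/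
def twoRoot (j : X.Node) (h : X.Coweight) : ℤ :=
  (∑ i, h.1 i * (X.twoD i : ℤ) * X.cartan i j) + (if j = 0 then 2 * h.2 else 0)

/-- The generators `e_i`, `f_i`, `q^h`. -/
inductive Gen
  | e (i : X.Node)
  | f (i : X.Node)
  | qh (h : X.Coweight)

/-- The free algebra on the generators. -/
abbrev Free : Type := FreeAlgebra K X.Gen

/-- The exponent `d_i h_i` of `t_i = q_i^{h_i}`. -/
def tExp (i : X.Node) : X.Coweight := (Pi.single i 1, 0)

/-- Generators in the free algebra. -/
noncomputable def fe (i : X.Node) : X.Free := FreeAlgebra.ι K (Gen.e i)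
/-- Generators in the free algebra. -/
noncomputable def ff (i : X.Node) : X.Free := FreeAlgebra.ι K (Gen.f i)
/-- Generators in the free algebra. -/
noncomputable def fq (h : X.Coweight) : X.Free := FreeAlgebra.ι K (Gen.qh h)

/-- The left side of the quantum Serre relation,
`∑_{m+n=1-A_{ij}} (-1)^m x_i^{(m)} x_j x_i^{(n)}` with `x_i^{(m)} = x_i^m / [m]_i!`. -/
noncomputable def serre (x : X.Node → X.Free) (i j : X.Node) : X.Free :=
  ∑ p ∈ Finset.HasAntidiagonal.antidiagonal (1 - X.cartan i j).toNat,
    ((-1 : K) ^ p.1 * (X.qFactorial i p.1)⁻¹ * (X.qFactorial i p.2)⁻¹) •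
      (x i ^ p.1 * x j * x i ^ p.2)

/-- The defining relations of `U_q(ĝ)`. -/
inductive Rel : X.Free → X.Free → Prop
  | qh_zero : Rel (X.fq 0) 1
  | qh_add (h h' : X.Coweight) : Rel (X.fq h * X.fq h') (X.fq (h + h'))
  | qh_e (h : X.Coweight) (i : X.Node) :
      Rel (X.fq h * X.fe i * X.fq (-h)) ((RatFunc.X ^ X.twoRoot i h : K) • X.fe i)
  | qh_f (h : X.Coweight) (i : X.Node) :
      Rel (X.fq h * X.ff i * X.fq (-h)) ((RatFunc.X ^ (-X.twoRoot i h) : K) • X.ff i)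
  | ef_same (i : X.Node) :
      Rel (X.fe i * X.ff i - X.ff i * X.fe i)
        ((X.q i - (X.q i)⁻¹)⁻¹ • (X.fq (X.tExp i) - X.fq (-X.tExp i)))
  | ef_ne (i j : X.Node) (hij : i ≠ j) : Rel (X.fe i * X.ff j - X.ff j * X.fe i) 0
  | serre_e (i j : X.Node) (hij : i ≠ j) : Rel (X.serre X.fe i j) 0
  | serre_f (i j : X.Node) (hij : i ≠ j) : Rel (X.serre X.ff i j) 0

/-- The quantum affine algebra `U_q(ĝ)` over `ℂ(q^{1/2})`. -/
abbrev U : Type := RingQuot X.Rel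

/-- `e_i ∈ U_q(ĝ)`. -/
noncomputable def eU (i : X.Node) : X.U := RingQuot.mkAlgHom K X.Rel (X.fe i)
/-- `f_i ∈ U_q(ĝ)`. -/
noncomputable def fU (i : X.Node) : X.U := RingQuot.mkAlgHom K X.Rel (X.ff i)
/-- `t_i ∈ U_q(ĝ)`. -/
noncomputable def tU (i : X.Node) : X.U := RingQuot.mkAlgHom K X.Rel (X.fq (X.tExp i))
/-- `t_i⁻¹ ∈ U_q(ĝ)`. -/
noncomputable def tInvU (i : X.Node) : X.U := RingQuot.mkAlgHom K X.Rel (X.fq (-X.tExp i))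

/-- The generators `e_i, f_i, t_i^{±1}` of the derived subalgebra. -/
def derivedGens : Set X.U :=
  Set.range X.eU ∪ Set.range X.fU ∪ Set.range X.tU ∪ Set.range X.tInvU

/-- The derived subalgebra `U'_q(ĝ)`. -/
noncomputable def derived : Subalgebra K X.U := Algebra.adjoin K X.derivedGens

/-- The algebra `U'_q(ĝ)`. -/
abbrev U' : Type := X.derived

/-- `e_i ∈ U'_q(ĝ)`. -/
noncomputable def e (i : X.Node) : X.U' :=
  ⟨X.eU i, Algebra.subset_adjoin (Or.inl (Or.inl (Or.inl ⟨i, rfl⟩)))⟩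
/-- `f_i ∈ U'_q(ĝ)`. -/
noncomputable def f (i : X.Node) : X.U' :=
  ⟨X.fU i, Algebra.subset_adjoin (Or.inl (Or.inl (Or.inr ⟨i, rfl⟩)))⟩
/-- `t_i ∈ U'_q(ĝ)`. -/
noncomputable def t (i : X.Node) : X.U' :=
  ⟨X.tU i, Algebra.subset_adjoin (Or.inl (Or.inr ⟨i, rfl⟩))⟩
/-- `t_i⁻¹ ∈ U'_q(ĝ)`. -/
noncomputable def tInv (i : X.Node) : X.U' :=
  ⟨X.tInvU i, Algebra.subset_adjoin (Or.inr ⟨i, rfl⟩)⟩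

/-! ### The representation graph -/

/-- The labels of the vertices, the barred vertex `ī` being written as the integer `-i`. -/
noncomputable def vertexSet : Finset ℤ :=
  match X.series with
  | .A => Finset.Icc 1 ((X.rank : ℤ) + 1)
  | .B => Finset.Icc (-(X.rank : ℤ)) X.rank
  | .C => (Finset.Icc (-(X.rank : ℤ)) X.rank).erase 0
  | .D => (Finset.Icc (-(X.rank : ℤ)) X.rank).erase 0

/-- The vertices of the representation graph; they index the basis `(v_i)` of `V`. -/
abbrev Vertex : Type := X.vertexSet

/-- The arrows `v → w` of color `k` of the representation graph, on labels. -/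
def arrowInt : Series → ℕ → ℕ → ℤ → ℤ → Prop
  | .A, n, k, v, w =>
    (1 ≤ k ∧ v = k ∧ w = k + 1) ∨
    (k = 0 ∧ v = n + 1 ∧ w = 1)
  | .B, n, k, v, w =>
    (1 ≤ k ∧ k < n ∧ ((v = k ∧ w = k + 1) ∨ (v = -(k + 1) ∧ w = -k))) ∨
    (k = n ∧ ((v = n ∧ w = 0) ∨ (v = 0 ∧ w = -n))) ∨
    (k = 0 ∧ ((v = -2 ∧ w = 1) ∨ (v = -1 ∧ w = 2)))
  | .C, n, k, v, w =>
    (1 ≤ k ∧ k < n ∧ ((v = k ∧ w = k + 1) ∨ (v = -(k + 1) ∧ w = -k))) ∨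
    (k = n ∧ v = n ∧ w = -n) ∨
    (k = 0 ∧ v = -1 ∧ w = 1)
  | .D, n, k, v, w =>
    (1 ≤ k ∧ k < n ∧ ((v = k ∧ w = k + 1) ∨ (v = -(k + 1) ∧ w = -k))) ∨
    (k = n ∧ ((v = n - 1 ∧ w = -n) ∨ (v = n ∧ w = -(n - 1)))) ∨
    (k = 0 ∧ ((v = -2 ∧ w = 1) ∨ (v = -1 ∧ w = 2)))

/-- `i` and `j` are joined by an arrow `i → j` of color `k`. -/
def Arrow (k : X.Node) (i j : X.Vertex) : Prop := arrowInt X.series X.rank k i j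

/-- The number of `k`-arrows going out of `i`, that is the number of arrows of the `k`-string
that starts at `i` (one for each vertex reached from `i` along `k`-arrows). -/
noncomputable def outArrows (k : X.Node) (i : X.Vertex) : ℕ :=
  Set.ncard {j | Relation.TransGen (X.Arrow k) i j}

/-- The number of `k`-arrows coming into `j`, counted along the `k`-string that ends at `j`. -/
noncomputable def inArrows (k : X.Node) (j : X.Vertex) : ℕ :=
  Set.ncard {i | Relation.TransGen (X.Arrow k) i j}

/-- `⟨wt(i), h_k⟩`, where `wt(i) = ∑_k (outArrows k i - inArrows k i) Λ_k`. -/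
noncomputable def wt (i : X.Vertex) (k : X.Node) : ℤ :=
  (X.outArrows k i : ℤ) - (X.inArrows k i : ℤ)

/-- The label of the vertex `1`. -/
noncomputable def firstVertex : X.Vertex :=
  ⟨1, by
    rcases X with ⟨s, n, h⟩
    cases s <;> simp [Series.minRank] at h <;> simp [vertexSet] <;> omega⟩

/-- The last vertex `1̄`; it is `n + 1` in type `A`. -/
noncomputable def lastVertex : X.Vertex :=
  ⟨match X.series with
    | .A => (X.rank : ℤ) + 1
    | _ => -1, by
    rcases X with ⟨s, n, h⟩
    cases s <;> simp [Series.minRank] at h <;> simp [vertexSet] <;> omega⟩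

/-! ### The representation `V` and its dual -/

/-- Matrices of the generators of `U'_q(ĝ)` in a basis indexed by the vertices. -/
structure Mats where
  e : X.Node → Matrix X.Vertex X.Vertex K
  f : X.Node → Matrix X.Vertex X.Vertex K
  t : X.Node → Matrix X.Vertex X.Vertex K
  tInv : X.Node → Matrix X.Vertex X.Vertex K

/-- The coefficient of `v_i` in `e_k v_j` for an arrow `i → j` of color `k`: it is `[2]_n` for
the arrow `n → 0` of color `n` in type `B`, and `1` otherwise. -/
noncomputable def eCoeff (k : X.Node) (i : X.Vertex) : K :=
  match X.series with
  | .B => if (k : ℕ) = X.rank ∧ (i : ℤ) = X.rank then X.qInt k 2 else 1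
  | _ => 1

/-- The coefficient of `v_j` in `f_k v_i` for an arrow `i → j` of color `k`: it is `[2]_n` for
the arrow `0 → n̄` of color `n` in type `B`, and `1` otherwise. -/
noncomputable def fCoeff (k : X.Node) (j : X.Vertex) : K :=
  match X.series with
  | .B => if (k : ℕ) = X.rank ∧ (j : ℤ) = -X.rank then X.qInt k 2 else 1
  | _ => 1

open Classical in
/-- The representation `V` described by the representation graph. -/
noncomputable def vectorRep : X.Mats where
  e k := Matrix.of fun i j => if X.Arrow k i j then X.eCoeff k i else 0
  f k := Matrix.of fun j i => if X.Arrow k i j then X.fCoeff k j else 0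
  t k := Matrix.diagonal fun i => X.q k ^ X.wt i k
  tInv k := Matrix.diagonal fun i => X.q k ^ (-X.wt i k)

variable {X}

/-- The dual representation `(x v^*)(u) = v^*(S(x) u)` in the dual basis, with the antipode
`S(e_k) = -t_k⁻¹ e_k`, `S(f_k) = -f_k t_k`, `S(t_k) = t_k⁻¹`. -/
noncomputable def Mats.dual (R : X.Mats) : X.Mats where
  e k := (-(R.tInv k * R.e k)).transpose
  f k := (-(R.f k * R.t k)).transpose
  t k := (R.tInv k).transpose
  tInv k := (R.t k).transpose

/-! ### The completed tensor product with an affinization -/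

variable (X) in
/-- The completed tensor product `V_z ⊗̂ N`, `V_z = V ⊗ K[z, z⁻¹]`: the family `w` is the formal
sum `∑_{j, m} (v_j ⊗ z^m) ⊗ w j m`. -/
abbrev Completed (N : Type*) : Type _ := X.Vertex → ℤ → N

section

variable {M N : Type*}
  [AddCommGroup M] [Module K M] [Module X.U' M] [IsScalarTower K X.U' M]
  [AddCommGroup N] [Module K N] [Module X.U' N] [IsScalarTower K X.U' N]

/-- The operator `(A z^s) ⊗ x` on `V_z ⊗̂ N`, where `A z^s` sends `v ⊗ z^m` to `A v ⊗ z^{m+s}`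
and `x ∈ U'_q(ĝ)`. -/
noncomputable def tensorOp (A : Matrix X.Vertex X.Vertex K) (s : ℤ) (x : X.U')
    (w : X.Completed N) : X.Completed N :=
  fun i m => ∑ j, A i j • (x • w j (m - s))

variable (X) in
/-- `δ_{k,0}`, the power of `z` by which `e_k` shifts the affinization. -/
def zdeg (k : X.Node) : ℤ := if k = 0 then 1 else 0

variable (M N) in
/-- A type II vertex operator with respect to the affinization of `R`: an operator
`Φ(z) : M → R_z ⊗̂ N` that intertwines the actions of `U'_q(ĝ)`, the one on the tensor product
being given by the coproduct `Δ(e_k) = e_k ⊗ 1 + t_k ⊗ e_k`, `Δ(f_k) = f_k ⊗ t_k⁻¹ + 1 ⊗ f_k`,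
`Δ(t_k) = t_k ⊗ t_k`. -/
@[ext]
structure TypeII (R : X.Mats) where
  toLin : M →ₗ[K] X.Completed N
  map_e : ∀ (k : X.Node) (u : M),
    toLin (X.e k • u) =
      tensorOp (R.e k) (X.zdeg k) 1 (toLin u) + tensorOp (R.t k) 0 (X.e k) (toLin u)
  map_f : ∀ (k : X.Node) (u : M),
    toLin (X.f k • u) =
      tensorOp (R.f k) (-X.zdeg k) (X.tInv k) (toLin u) + tensorOp 1 0 (X.f k) (toLin u)
  map_t : ∀ (k : X.Node) (u : M),
    toLin (X.t k • u) = tensorOp (R.t k) 0 (X.t k) (toLin u)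

/-- The component `Φ_j(z) : M → N[[z, z⁻¹]]`, where `Φ(z) u = ∑_j v_j ⊗ Φ_j(z) u`; a formal
series `∑_m w_m z^m` is the family of its coefficients. -/
noncomputable def TypeII.comp {R : X.Mats} (Φ : TypeII M N R) (j : X.Vertex) : M →ₗ[K] (ℤ → N) :=
  LinearMap.proj j ∘ₗ Φ.toLin

/-- Multiplication by `z^s` on `N[[z, z⁻¹]]`-valued operators. -/
noncomputable def zMul (s : ℤ) (Ψ : M →ₗ[K] (ℤ → N)) : M →ₗ[K] (ℤ → N) where
  toFun u m := Ψ u (m - s)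
  map_add' u v := by ext m; simp
  map_smul' c u := by ext m; simp

/-- `Ψ(z) x` for `x ∈ U'_q(ĝ)`. -/
noncomputable def mulRight (Ψ : M →ₗ[K] (ℤ → N)) (x : X.U') : M →ₗ[K] (ℤ → N) :=
  Ψ ∘ₗ Algebra.lsmul K K M x

/-- `x Ψ(z)` for `x ∈ U'_q(ĝ)`, which acts on `N[[z, z⁻¹]]` coefficientwise. -/
noncomputable def mulLeft (x : X.U') (Ψ : M →ₗ[K] (ℤ → N)) : M →ₗ[K] (ℤ → N) :=
  LinearMap.pi fun m => Algebra.lsmul K K N x ∘ₗ LinearMap.proj m ∘ₗ Ψ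

/-- `[Ψ(z), x]_c = Ψ(z) x - c x Ψ(z)`. -/
noncomputable def qCommRight (Ψ : M →ₗ[K] (ℤ → N)) (x : X.U') (c : K) : M →ₗ[K] (ℤ → N) :=
  mulRight Ψ x - c • mulLeft x Ψ

/-- `[x, Ψ(z)]_c = x Ψ(z) - c Ψ(z) x`. -/
noncomputable def qCommLeft (x : X.U') (Ψ : M →ₗ[K] (ℤ → N)) (c : K) : M →ₗ[K] (ℤ → N) :=
  mulLeft x Ψ - c • mulRight Ψ x

end

end AffineType

end QAff

/-! Only the relation for `e_k` is needed. Since `Δ(e_k) = e_k ⊗ 1 + t_k ⊗ e_k`, `t_k` is diagonal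
and a vertex has at most one outgoing `k`-arrow, an arrow `i → j` turns the `v_i`-coefficient of the
intertwining property into `Φ_i e_k = c z^{δ_{k,0}} Φ_j + q_k^{wt(i)} e_k Φ_i`, where `e_k v_j = c
v_i`. As `c ≠ 0`, this can be solved for `Φ_j`. Moreover `c = [r'_{i,k}]_k` (`qInt_outArrows`): a
`k`-string has at most two arrows, and two only for `n → 0 → n̄` in type `B`, whose first arrow
carries `[2]_n`.

On the dual, `e_k` is the transpose of `-t_k⁻¹ e_k`, so the `v_j^*`-coefficient expresses `Φ*_i`
through `Φ*_j`; the factor `q_k^2` is `q_k^{wt(i) - wt(j)}`.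

Uniqueness follows because every vertex is reached from `1` and leads to `1̄` (`vertex_induction`,
`vertex_induction_backward`). -/

namespace Relation

/-! ### Counting reachable elements along a functional relation -/

variable {α : Type*} {R : α → α → Prop}

/-- A cycle can be traversed repeatedly, so it would contain three consecutive steps. -/
theorem not_transGen_self_of_no_path
    (hR : ∀ a b c d, R a b → R b c → R c d → False) (a : α) : ¬ TransGen R a a := by
  intro h
  obtain ⟨b, hab, hba⟩ := TransGen.head'_iff.1 h
  obtain ⟨c, hbc, hca⟩ := TransGen.head'_iff.1 (TransGen.trans_right hba h)
  obtain ⟨d, hcd, -⟩ := TransGen.head'_iff.1 (TransGen.trans_right hca h)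
  exact hR a b c d hab hbc hcd

/-- Along a step of a functional relation without cycles, the number of elements that can be
reached drops by one. -/
theorem ncard_transGen_of_step [Finite α] {a b : α} (hab : R a b)
    (hfun : ∀ c, R a c → c = b) (hcyc : ¬ TransGen R b b) :
    Set.ncard {c | TransGen R a c} = Set.ncard {c | TransGen R b c} + 1 := by
  have : {c | TransGen R a c} = insert b {c | TransGen R b c} := by
    ext c
    simp only [Set.mem_ofPred_eq, Set.mem_insert_iff]
    constructor
    · intro h
      obtain ⟨d, had, hdc⟩ := TransGen.head'_iff.1 h
      obtain rfl := hfun d had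
      rcases reflTransGen_iff_eq_or_transGen.1 hdc with h | h
      · exact Or.inl h
      · exact Or.inr h
    · rintro (rfl | h)
      · exact TransGen.single hab
      · exact TransGen.head hab h
  -- Acyclicity keeps `b` out of the set reachable from `b`, so inserting it adds exactly one.
  rw [this, Set.ncard_insert_of_notMem (by simpa using hcyc)]

theorem ncard_transGen_of_terminal {a : α} (ha : ∀ b, ¬ R a b) :
    Set.ncard {c | TransGen R a c} = 0 := by
  have : {c | TransGen R a c} = ∅ := by
    ext c
    simp only [Set.mem_ofPred_eq, Set.mem_empty_iff_false, iff_false]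
    intro h
    obtain ⟨d, had, -⟩ := TransGen.head'_iff.1 h
    exact ha d had
  rw [this, Set.ncard_empty]

end Relation

namespace QAff.AffineType

/-! ### The representation graph -/

theorem arrowInt_right_unique {s : Series} {n k : ℕ} (hn : s.minRank ≤ n) {v w w' : ℤ}
    (h : arrowInt s n k v w) (h' : arrowInt s n k v w') : w' = w := by
  cases s <;> simp only [arrowInt, Series.minRank] at * <;> omega

theorem arrowInt_left_unique {s : Series} {n k : ℕ} (hn : s.minRank ≤ n) {v v' w : ℤ}
    (h : arrowInt s n k v w) (h' : arrowInt s n k v' w) : v' = v := by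
  cases s <;> simp only [arrowInt, Series.minRank] at * <;> omega

/-- Two consecutive arrows of the same color occur only in type `B`, along `n → 0 → n̄`. -/
theorem arrowInt_comp {s : Series} {n k : ℕ} (hn : s.minRank ≤ n) {u v w : ℤ}
    (h : arrowInt s n k u v) (h' : arrowInt s n k v w) :
    s = .B ∧ k = n ∧ u = n ∧ v = 0 ∧ w = -n := by
  cases s <;> simp only [arrowInt, Series.minRank, reduceCtorEq, true_and, false_and] at * <;> omega

/-- The arrow with the exceptional coefficient `[2]_n` never ends its string; this excludes it when
a string is known to end. -/
theorem arrowInt_B_last {n k : ℕ} (hn : 3 ≤ n) {v w : ℤ} (h : arrowInt .B n k v w)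
    (hk : k = n) (hv : v = n) : arrowInt .B n k w (-n) := by
  simp only [arrowInt] at h
  have hw : w = 0 := by omega
  simp [arrowInt, hk, hw]

theorem arrow_right_unique (X : AffineType) {k : X.Node} {i j j' : X.Vertex}
    (h : X.Arrow k i j) (h' : X.Arrow k i j') : j' = j :=
  Subtype.ext (arrowInt_right_unique X.minRank_le h h')

theorem arrow_left_unique (X : AffineType) {k : X.Node} {i i' j : X.Vertex}
    (h : X.Arrow k i j) (h' : X.Arrow k i' j) : i' = i :=
  Subtype.ext (arrowInt_left_unique X.minRank_le h h')

theorem arrow_no_path (X : AffineType) {k : X.Node} (a b c d : X.Vertex)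
    (hab : X.Arrow k a b) (hbc : X.Arrow k b c) (hcd : X.Arrow k c d) : False := by
  have hr := X.minRank_le
  -- The first pair of arrows gives `c = n̄`, the second `c = 0`, which is impossible for positive
  -- rank.
  obtain ⟨hs, -, -, -, h1⟩ := arrowInt_comp hr hab hbc
  obtain ⟨-, -, -, h2, -⟩ := arrowInt_comp hr hbc hcd
  simp only [hs, Series.minRank] at hr
  omega

theorem outArrows_of_arrow (X : AffineType) {k : X.Node} {i j : X.Vertex} (h : X.Arrow k i j) :
    X.outArrows k i = X.outArrows k j + 1 :=
  Relation.ncard_transGen_of_step h (fun _ h' => X.arrow_right_unique h h')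
    (Relation.not_transGen_self_of_no_path X.arrow_no_path j)

theorem inArrows_eq_swap (X : AffineType) (k : X.Node) (j : X.Vertex) :
    X.inArrows k j = Set.ncard {i | Relation.TransGen (Function.swap (X.Arrow k)) j i} := by
  simp only [inArrows, Relation.transGen_swap]

theorem inArrows_of_arrow (X : AffineType) {k : X.Node} {i j : X.Vertex} (h : X.Arrow k i j) :
    X.inArrows k j = X.inArrows k i + 1 := by
  rw [inArrows_eq_swap, inArrows_eq_swap]
  exact Relation.ncard_transGen_of_step (R := Function.swap (X.Arrow k)) h
    (fun _ h' => X.arrow_left_unique h h')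
    (Relation.not_transGen_self_of_no_path
      (fun a b c d hab hbc hcd => X.arrow_no_path d c b a hcd hbc hab) i)

/-- One outgoing arrow is lost and one incoming arrow gained. This is the source of `q_k^2` in the
dual formula. -/
theorem wt_of_arrow (X : AffineType) {k : X.Node} {i j : X.Vertex} (h : X.Arrow k i j) :
    X.wt i k = X.wt j k + 2 := by
  simp only [wt, X.outArrows_of_arrow h, X.inArrows_of_arrow h]
  push_cast
  ring

theorem outArrows_of_arrow_of_end (X : AffineType) {k : X.Node} {i j : X.Vertex}
    (h : X.Arrow k i j) (hj : ∀ x, ¬ X.Arrow k j x) : X.outArrows k i = 1 := by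
  rw [X.outArrows_of_arrow h, outArrows, Relation.ncard_transGen_of_terminal hj]

theorem outArrows_of_arrow_of_arrow (X : AffineType) {k : X.Node} {i j x : X.Vertex}
    (h : X.Arrow k i j) (h' : X.Arrow k j x) : X.outArrows k i = 2 := by
  rw [X.outArrows_of_arrow h, X.outArrows_of_arrow_of_end h' (fun _ => X.arrow_no_path _ _ _ _ h h')]

/-! ### Quantum integers -/

theorem q_ne_zero (X : AffineType) (k : X.Node) : X.q k ≠ 0 :=
  pow_ne_zero _ RatFunc.X_ne_zero

theorem ratFunc_X_pow_ne_C {m : ℕ} (hm : 0 < m) (c : ℂ) :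
    (RatFunc.X : K) ^ m ≠ RatFunc.C c := by
  intro h
  rw [← RatFunc.algebraMap_X, ← RatFunc.algebraMap_C, ← map_pow] at h
  have h' := RatFunc.algebraMap_injective ℂ h
  have := congrArg Polynomial.natDegree h'
  simp at this
  omega

theorem twoD_pos (X : AffineType) (k : X.Node) : 0 < X.twoD k := by
  rcases X with ⟨s, n, h⟩
  cases s <;> simp only [twoD] <;> (try split_ifs) <;> norm_num

/-- In particular `q_k` is not a root of unity: `q_k = q_k⁻¹` would give `q_k^2 = 1`, and `[2]_k =
0` would give `q_k^4 = 1`. -/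
theorem q_pow_ne_C (X : AffineType) (k : X.Node) {m : ℕ} (hm : 0 < m) (c : ℂ) :
    X.q k ^ m ≠ RatFunc.C c := by
  rw [q, ← pow_mul]
  exact ratFunc_X_pow_ne_C (Nat.mul_pos (X.twoD_pos k) hm) c

theorem q_sub_inv_ne_zero (X : AffineType) (k : X.Node) : X.q k - (X.q k)⁻¹ ≠ 0 := by
  intro h
  refine X.q_pow_ne_C k (m := 2) (by norm_num) 1 ?_
  have hq := X.q_ne_zero k
  field_simp at h
  rw [map_one]
  linear_combination h

theorem qInt_one (X : AffineType) (k : X.Node) : X.qInt k 1 = 1 := by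
  rw [qInt, pow_one, div_self (X.q_sub_inv_ne_zero k)]

theorem qInt_two_ne_zero (X : AffineType) (k : X.Node) : X.qInt k 2 ≠ 0 := by
  refine div_ne_zero ?_ (X.q_sub_inv_ne_zero k)
  intro h
  refine X.q_pow_ne_C k (m := 4) (by norm_num) 1 ?_
  have hq := X.q_ne_zero k
  field_simp at h
  rw [map_one]
  linear_combination h

theorem eCoeff_ne_zero (X : AffineType) (k : X.Node) (i : X.Vertex) : X.eCoeff k i ≠ 0 := by
  unfold eCoeff
  split
  · split_ifs
    · exact X.qInt_two_ne_zero k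
    · exact one_ne_zero
  · exact one_ne_zero

/-- The matrix coefficient of `e_k` along an arrow out of `i` is `[r'_{i,k}]_k`. -/
theorem qInt_outArrows (X : AffineType) {k : X.Node} {i j : X.Vertex} (h : X.Arrow k i j) :
    X.qInt k (X.outArrows k i) = X.eCoeff k i := by
  by_cases hj : ∃ x, X.Arrow k j x
  · obtain ⟨x, hx⟩ := hj
    obtain ⟨hs, hk, hi, -, -⟩ := arrowInt_comp X.minRank_le h hx
    rw [X.outArrows_of_arrow_of_arrow h hx]
    simp [eCoeff, hs, hk, hi]
  · push Not at hj
    rw [X.outArrows_of_arrow_of_end h hj, qInt_one]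
    rcases X with ⟨s, n, hr⟩
    cases s <;> simp only [eCoeff]
    -- Only type `B` is left; its exceptional arrow would continue to `n̄`, against `hj`.
    rw [if_neg]
    rintro ⟨hk, hi⟩
    refine hj ⟨-(n : ℤ), by simp [vertexSet]⟩ ?_
    exact arrowInt_B_last hr h hk hi

/-! ### Connectedness of the representation graph -/

/-- Go up `1 → ⋯ → n`, cross by arrows of color `n`, then follow `n̄ → ⋯ → 1̄`; color `0` is not
needed. Integer labels make both chains inductions on intervals. -/
theorem forall_mem_vertexSet_of_forward (X : AffineType) {P : ℤ → Prop} (h1 : P 1)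
    (hP : ∀ (k : ℕ) (v w : ℤ), k ≤ X.rank → arrowInt X.series X.rank k v w → P v → P w) :
    ∀ v ∈ X.vertexSet, P v := by
  rcases X with ⟨s, n, hn⟩
  change ∀ (k : ℕ) (v w : ℤ), k ≤ n → arrowInt s n k v w → P v → P w at hP
  have hpos : ∀ v : ℤ, 1 ≤ v → v ≤ n → P v := by
    intro v hv
    induction v, hv using Int.leInduction with
    | base => exact fun _ => h1
    | succ m hm ih =>
      intro hmn
      refine hP m.toNat m (m + 1) (by omega) ?_ (ih (by omega))
      cases s <;> simp only [arrowInt] <;> omega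
  have hneg (hs : s ≠ .A) (hlast : P (-n)) : ∀ v : ℤ, -n ≤ v → v ≤ -1 → P v := by
    intro v hv
    induction v, hv using Int.leInduction with
    | base => exact fun _ => hlast
    | succ m hm ih =>
      intro hmn
      -- The arrow from the bar of `k + 1` to `k̄` is `m → m + 1` with `k = -(m + 1)`.
      refine hP (-(m + 1)).toNat m (m + 1) (by omega) ?_ (ih (by omega))
      cases s <;> simp only [arrowInt, ne_eq, not_true_eq_false] at hs ⊢ <;> omega
  intro v hv
  cases s <;> simp only [vertexSet, Series.minRank, Finset.mem_Icc, Finset.mem_erase] at hv hn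
  · rcases eq_or_ne v (n + 1) with rfl | hv'
    · exact hP n n (n + 1) le_rfl (by simp [arrowInt]; omega) (hpos n (by omega) le_rfl)
    · exact hpos v hv.1 (by omega)
  · have h0 : P 0 := hP n n 0 le_rfl (by simp [arrowInt]) (hpos n (by omega) le_rfl)
    rcases lt_trichotomy v 0 with h | rfl | h
    · exact hneg (by simp) (hP n 0 (-n) le_rfl (by simp [arrowInt]) h0) v hv.1 (by omega)
    · exact h0
    · exact hpos v h hv.2
  · rcases lt_or_gt_of_ne hv.1 with h | h
    · exact hneg (by simp) (hP n n (-n) le_rfl (by simp [arrowInt]) (hpos n (by omega) le_rfl))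
        v hv.2.1 (by omega)
    · exact hpos v h hv.2.2
  · rcases lt_or_gt_of_ne hv.1 with h | h
    -- In type `D` the vertex `n̄` is entered from `n - 1`, since the `n`-arrow out of `n` skips it.
    · exact hneg (by simp) (hP n (n - 1) (-n) le_rfl (by simp [arrowInt])
        (hpos (n - 1) (by omega) (by omega))) v hv.2.1 (by omega)
    · exact hpos v h hv.2.2

theorem forall_mem_vertexSet_of_backward (X : AffineType) {P : ℤ → Prop} (h1 : P X.lastVertex)
    (hP : ∀ (k : ℕ) (v w : ℤ), k ≤ X.rank → arrowInt X.series X.rank k v w → P w → P v) :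
    ∀ v ∈ X.vertexSet, P v := by
  rcases X with ⟨s, n, hn⟩
  change ∀ (k : ℕ) (v w : ℤ), k ≤ n → arrowInt s n k v w → P w → P v at hP
  have hpos (hlast : P n) : ∀ v : ℤ, v ≤ n → 1 ≤ v → P v := by
    intro v hv
    induction v, hv using Int.leInductionDown with
    | base => exact fun _ => hlast
    | pred m hm ih =>
      intro hmn
      refine hP (m - 1).toNat (m - 1) m (by omega) ?_ (ih (by omega))
      cases s <;> simp only [arrowInt] <;> omega
  have hneg (hs : s ≠ .A) : ∀ v : ℤ, v ≤ -1 → -n ≤ v → P v := by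
    intro v hv
    induction v, hv using Int.leInductionDown with
    | base =>
      intro _
      cases s
      · exact absurd rfl hs
      all_goals exact h1
    | pred m hm ih =>
      intro hmn
      refine hP (-m).toNat (m - 1) m (by omega) ?_ (ih (by omega))
      cases s <;> simp only [arrowInt, ne_eq, not_true_eq_false] at hs ⊢ <;> omega
  intro v hv
  cases s <;> simp only [vertexSet, Series.minRank, Finset.mem_Icc, Finset.mem_erase] at hv hn
  · change P (n + 1) at h1
    rcases eq_or_ne v (n + 1) with rfl | hv'
    · exact h1
    · exact hpos (hP n n (n + 1) le_rfl (by simp [arrowInt]; omega) h1) v (by omega) hv.1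
  · have h0 : P 0 := hP n 0 (-n) le_rfl (by simp [arrowInt]) (hneg (by simp) _ (by omega) le_rfl)
    rcases lt_trichotomy v 0 with h | rfl | h
    · exact hneg (by simp) v (by omega) hv.1
    · exact h0
    · exact hpos (hP n n 0 le_rfl (by simp [arrowInt]) h0) v hv.2 h
  · rcases lt_or_gt_of_ne hv.1 with h | h
    · exact hneg (by simp) v (by omega) hv.2.1
    · exact hpos (hP n n (-n) le_rfl (by simp [arrowInt]) (hneg (by simp) _ (by omega) le_rfl))
        v hv.2.2 h
  · rcases lt_or_gt_of_ne hv.1 with h | h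
    · exact hneg (by simp) v (by omega) hv.2.1
    -- In type `D` the `n`-arrow out of `n` ends at the bar of `n - 1`, so the crossing starts
    -- there.
    · exact hpos (hP n n (-(n - 1)) le_rfl (by simp [arrowInt])
        (hneg (by simp) _ (by omega) (by omega))) v hv.2.2 h

theorem mem_vertexSet_of_arrowInt (X : AffineType) {k : ℕ} (hk : k ≤ X.rank) {v w : ℤ}
    (h : arrowInt X.series X.rank k v w) : v ∈ X.vertexSet ∧ w ∈ X.vertexSet := by
  rcases X with ⟨s, n, hn⟩
  change arrowInt s n k v w at h
  change k ≤ n at hk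
  cases s <;> change _ ≤ n at hn <;> simp only [Series.minRank] at hn <;>
    simp only [arrowInt] at h <;>
    simp only [vertexSet, Finset.mem_Icc, Finset.mem_erase] <;> omega

/-- Every vertex can be reached from `1` along arrows. -/
theorem vertex_induction (X : AffineType) {P : X.Vertex → Prop} (h1 : P X.firstVertex)
    (hP : ∀ (k : X.Node) (i j : X.Vertex), X.Arrow k i j → P i → P j) (i : X.Vertex) : P i := by
  -- Quantifying over membership proofs extends `P` to all integer labels.
  have := X.forall_mem_vertexSet_of_forward (P := fun v => ∀ hv : v ∈ X.vertexSet, P ⟨v, hv⟩)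
    (fun _ => h1) (fun k v w hk h ih hw =>
      hP ⟨k, Nat.lt_succ_of_le hk⟩ ⟨v, (X.mem_vertexSet_of_arrowInt hk h).1⟩ ⟨w, hw⟩ h (ih _))
  exact this i i.2 i.2

/-- From every vertex one can reach `1̄` along arrows. -/
theorem vertex_induction_backward (X : AffineType) {P : X.Vertex → Prop} (h1 : P X.lastVertex)
    (hP : ∀ (k : X.Node) (i j : X.Vertex), X.Arrow k i j → P j → P i) (i : X.Vertex) : P i := by
  have := X.forall_mem_vertexSet_of_backward (P := fun v => ∀ hv : v ∈ X.vertexSet, P ⟨v, hv⟩)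
    (fun _ => h1) (fun k v w hk h ih hv =>
      hP ⟨k, Nat.lt_succ_of_le hk⟩ ⟨v, hv⟩ ⟨w, (X.mem_vertexSet_of_arrowInt hk h).2⟩ h (ih _))
  exact this i i.2 i.2

/-! ### Components of a vertex operator -/

section

variable {X : AffineType} {M N : Type*}
  [AddCommGroup M] [Module K M] [Module X.U' M]
  [AddCommGroup N] [Module K N] [Module X.U' N]

theorem tensorOp_apply_of_row {A : Matrix X.Vertex X.Vertex K} (s : ℤ) (x : X.U')
    (w : X.Completed N) {i j : X.Vertex} (hA : ∀ l, l ≠ j → A i l = 0) (m : ℤ) :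
    tensorOp A s x w i m = A i j • (x • w j (m - s)) := by
  rw [tensorOp, Finset.sum_eq_single j (fun l _ hl => by rw [hA l hl, zero_smul])
    (fun h => absurd (Finset.mem_univ j) h)]

theorem TypeII.ext_comp {R : X.Mats} {Φ Ψ : TypeII M N R} (h : ∀ j, Φ.comp j = Ψ.comp j) :
    Φ = Ψ := by
  refine TypeII.ext (LinearMap.ext fun u => funext fun j => ?_)
  exact LinearMap.congr_fun (h j) u

/-- The component along `i` of the intertwining property for `e_k`, when only the basis vector
`j` contributes to the coefficient of the basis vector `i` in the image of `e_k`. -/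
theorem TypeII.comp_e_smul {R : X.Mats} (Φ : TypeII M N R) {k : X.Node} {i j : X.Vertex}
    (he : ∀ l, l ≠ j → R.e k i l = 0) (ht : ∀ l, l ≠ i → R.t k i l = 0) (u : M) (m : ℤ) :
    Φ.comp i (X.e k • u) m =
      R.e k i j • Φ.comp j u (m - X.zdeg k) + R.t k i i • (X.e k • Φ.comp i u m) := by
  change Φ.toLin (X.e k • u) i m = _
  rw [Φ.map_e]
  simp only [Pi.add_apply]
  rw [tensorOp_apply_of_row _ _ _ he, tensorOp_apply_of_row _ _ _ ht, one_smul, sub_zero]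
  rfl

theorem vectorRep_e_apply {k : X.Node} {i j : X.Vertex} (h : X.Arrow k i j) :
    X.vectorRep.e k i j = X.eCoeff k i := by
  simp [vectorRep, h]

theorem vectorRep_e_row {k : X.Node} {i j : X.Vertex} (h : X.Arrow k i j) (l : X.Vertex)
    (hl : l ≠ j) : X.vectorRep.e k i l = 0 := by
  have : ¬ X.Arrow k i l := fun h' => hl (X.arrow_right_unique h h')
  simp [vectorRep, this]

theorem dual_e_apply (k : X.Node) (i j : X.Vertex) :
    X.vectorRep.dual.e k j i = -(X.q k ^ (-X.wt i k) * X.vectorRep.e k i j) := by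
  simp [Mats.dual, vectorRep, mul_comm]

/-- Transposition exchanges the roles: uniqueness of the incoming arrow is what counts here. -/
theorem dual_e_row {k : X.Node} {i j : X.Vertex} (h : X.Arrow k i j) (l : X.Vertex)
    (hl : l ≠ i) : X.vectorRep.dual.e k j l = 0 := by
  have : ¬ X.Arrow k l j := fun h' => hl (X.arrow_left_unique h h')
  rw [dual_e_apply]
  simp [vectorRep, this]

variable [IsScalarTower K X.U' M] [IsScalarTower K X.U' N]

theorem TypeII.comp_of_arrow (Φ : TypeII M N X.vectorRep) {k : X.Node} {i j : X.Vertex}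
    (h : X.Arrow k i j) :
    Φ.comp j = zMul (-X.zdeg k)
      ((X.qInt k (X.outArrows k i))⁻¹ •
        qCommRight (Φ.comp i) (X.e k) (X.q k ^ X.wt i k)) := by
  ext u m
  -- The degree `m + δ_{k,0}` undoes the shift of `e_k`, leaving the coefficient of `z^m` in `Φ_j`.
  have key := Φ.comp_e_smul (vectorRep_e_row h)
    (fun l hl => by simp [vectorRep, hl.symm]) u (m + X.zdeg k)
  have ht : X.vectorRep.t k i i = X.q k ^ X.wt i k := by simp [vectorRep]
  rw [vectorRep_e_apply h, ht, add_sub_cancel_right] at key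
  rw [X.qInt_outArrows h]
  change _ = (X.eCoeff k i)⁻¹ • (Φ.comp i (X.e k • u) (m - -X.zdeg k) -
    X.q k ^ X.wt i k • (X.e k • Φ.comp i u (m - -X.zdeg k)))
  rw [sub_neg_eq_add, key, add_sub_cancel_right, inv_smul_smul₀ (X.eCoeff_ne_zero k i)]

/-- The `v_j^*`-coefficient reads `Φ*_j e_k = -q_k^{-wt(i)} c z^{δ_{k,0}} Φ*_i + q_k^{-wt(j)} e_k
Φ*_j`. Multiplying by `q_k^{wt(j)}` produces the commutator and leaves `q_k^{wt(j) - wt(i)} =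
q_k^{-2}` in front of `Φ*_i`. -/
theorem TypeII.comp_of_arrow_dual (Φ : TypeII M N X.vectorRep.dual) {k : X.Node}
    {i j : X.Vertex} (h : X.Arrow k i j) :
    Φ.comp i = zMul (-X.zdeg k)
      ((X.q k ^ 2 * (X.qInt k (X.outArrows k i))⁻¹) •
        qCommLeft (X.e k) (Φ.comp j) (X.q k ^ X.wt j k)) := by
  ext u m
  have key := Φ.comp_e_smul (dual_e_row h)
    (fun l hl => by simp [Mats.dual, vectorRep, hl.symm]) u (m + X.zdeg k)
  have ht : X.vectorRep.dual.t k j j = X.q k ^ (-X.wt j k) := by simp [Mats.dual, vectorRep]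
  have hq := X.q_ne_zero k
  have hc := X.eCoeff_ne_zero k i
  have hw := zpow_ne_zero (X.wt j k) hq
  rw [dual_e_apply, vectorRep_e_apply h, ht, add_sub_cancel_right, X.wt_of_arrow h] at key
  rw [X.qInt_outArrows h]
  change _ = (X.q k ^ 2 * (X.eCoeff k i)⁻¹) • (X.e k • Φ.comp j u (m - -X.zdeg k) -
    X.q k ^ X.wt j k • Φ.comp j (X.e k • u) (m - -X.zdeg k))
  rw [sub_neg_eq_add, key]
  -- The two `e_k Φ*_j` terms cancel; only a scalar identity for the coefficient of `Φ*_i` remains.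
  rw [smul_add, smul_smul, smul_smul, zpow_neg _ (X.wt j k), mul_inv_cancel₀ hw, one_smul, sub_add_cancel_right,
    ← neg_smul, smul_smul, ← one_smul K (Φ.comp i u m), smul_smul]
  congr 1
  rw [zpow_neg, zpow_add₀ hq, zpow_ofNat]
  field_simp

end

end QAff.AffineType

open QAff QAff.AffineType in
theorem propositionP (X : AffineType) {M N : Type*}
    [AddCommGroup M] [Module K M] [Module X.U' M] [IsScalarTower K X.U' M]
    [AddCommGroup N] [Module K N] [Module X.U' N] [IsScalarTower K X.U' N] :
    ((∀ Φ Ψ : TypeII M N X.vectorRep,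
        Φ.comp X.firstVertex = Ψ.comp X.firstVertex → Φ = Ψ) ∧
      (∀ (Φ : TypeII M N X.vectorRep) (k : X.Node) (i j : X.Vertex), X.Arrow k i j →
        Φ.comp j = zMul (-X.zdeg k)
          ((X.qInt k (X.outArrows k i))⁻¹ •
            qCommRight (Φ.comp i) (X.e k) (X.q k ^ X.wt i k)))) ∧
    ((∀ Φ Ψ : TypeII M N X.vectorRep.dual,
        Φ.comp X.lastVertex = Ψ.comp X.lastVertex → Φ = Ψ) ∧
      (∀ (Φ : TypeII M N X.vectorRep.dual) (k : X.Node) (i j : X.Vertex), X.Arrow k i j →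
        Φ.comp i = zMul (-X.zdeg k)
          ((X.q k ^ 2 * (X.qInt k (X.outArrows k i))⁻¹) •
            qCommLeft (X.e k) (Φ.comp j) (X.q k ^ X.wt j k)))) := by
  refine ⟨⟨fun Φ Ψ h => ?_, fun Φ k i j hij => Φ.comp_of_arrow hij⟩,
    fun Φ Ψ h => ?_, fun Φ k i j hij => Φ.comp_of_arrow_dual hij⟩
  · refine TypeII.ext_comp (X.vertex_induction h fun k i j hij hi => ?_)
    rw [Φ.comp_of_arrow hij, Ψ.comp_of_arrow hij, hi]
  · refine TypeII.ext_comp (X.vertex_induction_backward h fun k i j hij hj => ?_)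
    rw [Φ.comp_of_arrow_dual hij, Ψ.comp_of_arrow_dual hij, hj]
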